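/- Let $k,m\in\mathbb{N}$, let $\mathcal{M}_k$ be the algebra of complex $k\times k$ matrices, and identify $\mathcal{M}_k\otimes\mathcal{M}_m\simeq\mathcal{M}_{km}$ via the Kronecker product. A state is a (not necessarily normalized) positive semidefinite Hermitian matrix $\gamma\in\mathcal{M}_k\otimes\mathcal{M}_m$; it is pure if it has rank $1$, and separable if $\gamma=\sum_{i=1}^n C_i\otimes D_i$ with $C_i\in\mathcal{M}_k$ and $D_i\in\mathcal{M}_m$ positive semidefinite. For $\gamma=\sum_{i=1}^n A_i\otimes B_i$ let $G_\gamma:\mathcal{M}_k\to\mathcal{M}_m$ and $F_\gamma:\mathcal{M}_m\to\mathcal{M}_k$ be given by $G_\gamma(X)=\sum_{i}\operatorname{tr}(A_iX)B_i$ and $F_\gamma(Y)=\sum_{i}\operatorname{tr}(B_iY)A_i$. A positive map $T:\mathcal{M}_k\to\mathcal{M}_k$ that is self-adjoint with respect to the trace inner product $\langle X,Y\rangle=\operatorname{tr}(XY^*)$ is called completely reducible if there are orthogonal projections $W_1,\dots,W_l\in\mathcal{M}_k$ ($l\ge 0$) with $W_iW_j=0$ for $i\neq j$ such that, for every $i$,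 $T(W_i\mathcal{M}_kW_i)\subset W_i\mathcal{M}_kW_i$ and $T|_{W_i\mathcal{M}_kW_i}$ is irreducible (that is, if $W$ is an orthogonal projection with $W\mathcal{M}_kW\subset W_i\mathcal{M}_kW_i$ and $T(W\mathcal{M}_kW)\subset W\mathcal{M}_kW$, then $W=0$ or $W=W_i$), and such that $T$ vanishes on the orthogonal complement of $\bigoplus_{i=1}^l W_i\mathcal{M}_kW_i$ in $\mathcal{M}_k$. Let $$CR_{k,m}=\{\gamma\in\mathcal{M}_k\otimes\mathcal{M}_m:\ \gamma\ge 0\text{ and }F_\gamma\circ G_\gamma:\mathcal{M}_k\to\mathcal{M}_k\text{ is completely reducible}\}.$$ The ray generated by $\gamma\neq 0$ is $\{\lambda\gamma:\lambda>0\}$. A ray $r\subset CR_{k,m}$ is an extreme ray of $CR_{k,m}$ if, whenever $A,B\in CR_{k,m}$ and $A+B\in r$, both $A$ and $B$ belong to $r\cup\{0\}$. **Proposition.** The extreme rays of $CR_{k,m}$ are exactly the rays generated by separable pure states of $\mathcal{M}_k\otimes\mathcal{M}_m$. -/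

import Mathlib

open scoped ComplexOrder Kronecker Matrix

noncomputable section

namespace CompletelyReducible

/-- Complex matrices of order `k`. -/
abbrev Mat (k : ℕ) : Type := Matrix (Fin k) (Fin k) ℂ

/-- `M_k ⊗ M_m`, identified with the matrices of order `k m` via the Kronecker product. -/
abbrev BiMat (k m : ℕ) : Type := Matrix (Fin k × Fin m) (Fin k × Fin m) ℂ

/-- The sub-algebra `V M_k V = {V X V : X ∈ M_k}`. -/
def corner {k : ℕ} (V : Mat k) : Submodule ℂ (Mat k) :=
  LinearMap.range (LinearMap.mulLeft ℂ V ∘ₗ LinearMap.mulRight ℂ V)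

theorem mem_corner {k : ℕ} {V X : Mat k} : X ∈ corner V ↔ ∃ Y : Mat k, V * Y * V = X := by
  simp [corner, mul_assoc]

/-- `T` leaves the sub-algebra `W M_k W` invariant. -/
def LeavesInvariant {k : ℕ} (T : Mat k →ₗ[ℂ] Mat k) (W : Mat k) : Prop :=
  ∀ X ∈ corner W, T X ∈ corner W

/-- Irreducibility of the restriction of `T` to `V M_k V` (a sub-algebra which `T` leaves
invariant): the only sub-algebras `W M_k W ⊆ V M_k V`, with `W` an orthogonal projection,
which `T` leaves invariant are those with `W = 0` or `W = V`. -/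
def IsIrreducibleOn {k : ℕ} (T : Mat k →ₗ[ℂ] Mat k) (V : Mat k) : Prop :=
  ∀ W : Mat k, IsStarProjection W → corner W ≤ corner V → LeavesInvariant T W → W = 0 ∨ W = V

/-- Complete reducibility of a (positive, self-adjoint) map `T : M_k → M_k`: there are mutually
orthogonal orthogonal projections `W_1, …, W_l` such that `T` leaves every `W_i M_k W_i` invariant,
is irreducible on each of them, and vanishes on the orthogonal complement `R` of
`⨁ W_i M_k W_i` in `M_k` with respect to the trace inner product `⟨X, Y⟩ = tr (X Y*)`.
Since `W_i W_j = 0` for `i ≠ j`, the spaces `W_i M_k W_i` are mutually orthogonal, so that the sum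
`M_k = ⨁ W_i M_k W_i ⊕ R` is automatically direct. -/
def IsCompletelyReducible {k : ℕ} (T : Mat k →ₗ[ℂ] Mat k) : Prop :=
  ∃ (l : ℕ) (W : Fin l → Mat k),
    (∀ i, IsStarProjection (W i)) ∧
    (∀ i j, i ≠ j → W i * W j = 0) ∧
    (∀ i, LeavesInvariant T (W i)) ∧
    (∀ i, IsIrreducibleOn T (W i)) ∧
    ∀ X : Mat k, (∀ i, ∀ Y ∈ corner (W i), (X * Yᴴ).trace = 0) → T X = 0

/-- The map `G_γ : M_k → M_m`, `G_γ(X) = ∑ tr(A_i X) B_i` for `γ = ∑ A_i ⊗ B_i`, in entries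
(see `gMap_sum_kronecker`). -/
def gMap {k m : ℕ} (γ : BiMat k m) : Mat k →ₗ[ℂ] Mat m where
  toFun X := Matrix.of fun b d => ∑ a, ∑ c, γ (a, b) (c, d) * X c a
  map_add' X Y := by
    ext b d
    simp [mul_add, Finset.sum_add_distrib]
  map_smul' t X := by
    ext b d
    simp [Finset.mul_sum, mul_left_comm]

/-- The map `F_γ : M_m → M_k`, `F_γ(Y) = ∑ tr(B_i Y) A_i` for `γ = ∑ A_i ⊗ B_i`, in entries
(see `fMap_sum_kronecker`). -/
def fMap {k m : ℕ} (γ : BiMat k m) : Mat m →ₗ[ℂ] Mat k where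
  toFun Y := Matrix.of fun a c => ∑ b, ∑ d, γ (a, b) (c, d) * Y d b
  map_add' X Y := by
    ext b d
    simp [mul_add, Finset.sum_add_distrib]
  map_smul' t X := by
    ext b d
    simp [Finset.mul_sum, mul_left_comm]

theorem gMap_sum_kronecker {k m n : ℕ} (A : Fin n → Mat k) (B : Fin n → Mat m) (X : Mat k) :
    gMap (∑ i, A i ⊗ₖ B i) X = ∑ i, (A i * X).trace • B i := by
  ext b d
  simp only [gMap, LinearMap.coe_mk, AddHom.coe_mk, Matrix.of_apply, Matrix.sum_apply,
    Matrix.kroneckerMap_apply, Matrix.smul_apply, Matrix.trace, Matrix.diag, Matrix.mul_apply,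
    smul_eq_mul, Finset.sum_mul]
  conv_rhs => rw [Finset.sum_comm]
  refine Finset.sum_congr rfl fun a _ => ?_
  conv_rhs => rw [Finset.sum_comm]
  refine Finset.sum_congr rfl fun c _ => Finset.sum_congr rfl fun i _ => ?_
  ring

theorem fMap_sum_kronecker {k m n : ℕ} (A : Fin n → Mat k) (B : Fin n → Mat m) (Y : Mat m) :
    fMap (∑ i, A i ⊗ₖ B i) Y = ∑ i, (B i * Y).trace • A i := by
  ext b d
  simp only [fMap, LinearMap.coe_mk, AddHom.coe_mk, Matrix.of_apply, Matrix.sum_apply,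
    Matrix.kroneckerMap_apply, Matrix.smul_apply, Matrix.trace, Matrix.diag, Matrix.mul_apply,
    smul_eq_mul, Finset.sum_mul]
  conv_rhs => rw [Finset.sum_comm]
  refine Finset.sum_congr rfl fun a _ => ?_
  conv_rhs => rw [Finset.sum_comm]
  refine Finset.sum_congr rfl fun c _ => Finset.sum_congr rfl fun i _ => ?_
  ring

/-- The set `CR_{k,m}` of completely reducible states: the positive semidefinite `γ` (states are
not normalized) such that `F_γ ∘ G_γ : M_k → M_k`, a positive self-adjoint map, is completely
reducible. -/
def CR (k m : ℕ) : Set (BiMat k m) :=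
  {γ | γ.PosSemidef ∧ IsCompletelyReducible (fMap γ ∘ₗ gMap γ)}

/-- A pure state: a positive semidefinite matrix of rank one. -/
def IsPure {k m : ℕ} (γ : BiMat k m) : Prop :=
  γ.PosSemidef ∧ γ.rank = 1

/-- A separable state: a finite sum of Kronecker products of positive semidefinite matrices. -/
def IsSeparable {k m : ℕ} (γ : BiMat k m) : Prop :=
  ∃ (n : ℕ) (C : Fin n → Mat k) (D : Fin n → Mat m),
    (∀ i, (C i).PosSemidef) ∧ (∀ i, (D i).PosSemidef) ∧ γ = ∑ i, C i ⊗ₖ D i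

/-- The ray `{t x : t > 0}` generated by `x`. -/
def ray {E : Type*} [AddCommGroup E] [Module ℝ E] (x : E) : Set E :=
  {y | ∃ t : ℝ, 0 < t ∧ y = t • x}

/-- `r` is an extreme ray of the convex cone `K`: it is the ray generated by a nonzero vector,
it is contained in `K`, and whenever `A + B ∈ r` with `A, B ∈ K`, both `A` and `B` lie in
`r ∪ {0}`. -/
def IsExtremeRay {E : Type*} [AddCommGroup E] [Module ℝ E] (K : Set E) (r : Set E) : Prop :=
  (∃ x : E, x ≠ 0 ∧ r = ray x) ∧ r ⊆ K ∧
    ∀ A ∈ K, ∀ B ∈ K, A + B ∈ r → (A ∈ r ∨ A = 0) ∧ (B ∈ r ∨ B = 0)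

end CompletelyReducible

end

/-! Write T = F_γ ∘ G_γ. Since F_γ is adjoint to G_γ for the trace form, T kills X only if G_γ does,
and the corner of a projection W is T-invariant exactly when tr(G_γ(W) G_γ(1-W)) = 0
(`leavesInvariant_iff`). This trace can only grow with γ, so irreducibility on a corner passes from
γ to every δ ≥ cγ with c > 0 (`isIrreducibleOn_of_le`).

Extreme implies pure and separable. A completely reducible γ is the sum of its blocks (W_i ⊗ 1) γ
(W_i ⊗ 1). Splitting off one block stays in CR, so an extreme x is a single block on which T is
irreducible. If U = uu* ≤ x, then x/2 ± U/4 lie in the same block and dominate a positive multiple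
of x, so both are in CR. Extremality makes U proportional to x, so x is pure. Reading its vector as
a matrix U, T becomes X ↦ P X P with P = UU*. An eigenline of P with nonzero eigenvalue gives an
invariant corner, so by irreducibility W projects onto that line, U has rank one and the vector is a
product.

Conversely, a separable pure state is a product state (`exists_eq_smul_product`). It lies in CR
because a one-dimensional corner is always irreducible, and its ray is already extreme in the whole
positive semidefinite cone. -/

noncomputable section

namespace CompletelyReducible

open Matrix

/-! ### Positive semidefinite matrices and rank one -/

section PosSemidef

theorem vecMulVec_star_ne_zero {n : Type*} {u : n → ℂ} (hu : u ≠ 0) :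
    vecMulVec u (star u) ≠ 0 := by
  simp [vecMulVec_eq_zero, hu]

theorem smul_vecMulVec_star {n : Type*} {t : ℝ} (ht : 0 ≤ t) (u : n → ℂ) :
    t • vecMulVec u (star u) = vecMulVec (√t • u) (star (√t • u)) := by
  rw [star_smul, star_trivial √t, smul_vecMulVec, vecMulVec_smul, smul_smul, Real.mul_self_sqrt ht]

variable {n p : Type*} [Fintype n]

theorem mul_eq_zero_of_conjTranspose_mul_mul_eq_zero {A : Matrix n n ℂ} (hA : A.PosSemidef)
    {N : Matrix n p ℂ} (h : Nᴴ * A * N = 0) : A * N = 0 := by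
  ext i j
  refine congrFun ((hA.dotProduct_mulVec_zero_iff fun a => N a j).mp ?_) i
  have := congrFun (congrFun h j) j
  rw [Matrix.mul_assoc] at this
  exact this

/-- On the kernel of B the forms of A and B - A are opposite and both nonnegative, so both vanish.
-/
theorem mul_eq_zero_of_le [Fintype p] {A B : Matrix n n ℂ} (hA : A.PosSemidef)
    (hB : (B - A).PosSemidef) {N : Matrix n p ℂ} (h : B * N = 0) : A * N = 0 := by
  classical
  refine mul_eq_zero_of_conjTranspose_mul_mul_eq_zero hA ?_
  have h1 := hA.conjTranspose_mul_mul_same N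
  have h2 := hB.conjTranspose_mul_mul_same N
  rw [Matrix.mul_sub, Matrix.sub_mul, Matrix.mul_assoc _ B, h, Matrix.mul_zero, zero_sub] at h2
  refine h1.trace_eq_zero_iff.mp (le_antisymm ?_ h1.trace_nonneg)
  simpa using h2.trace_nonneg

theorem trace_mul_nonneg {A B : Matrix n n ℂ} (hA : A.PosSemidef) (hB : B.PosSemidef) :
    0 ≤ (A * B).trace := by
  obtain ⟨k, v, rfl⟩ := posSemidef_iff_eq_sum_vecMulVec.mp hA
  rw [Finset.sum_mul, trace_sum]
  refine Finset.sum_nonneg fun i _ => ?_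
  rw [vecMulVec_mul, trace_vecMulVec, dotProduct_comm, ← dotProduct_mulVec]
  exact hB.dotProduct_mulVec_nonneg _

theorem exists_vecMulVec_le {A : Matrix n n ℂ} (hA : A.PosSemidef) (h : A ≠ 0) :
    ∃ u : n → ℂ, u ≠ 0 ∧ (A - vecMulVec u (star u)).PosSemidef := by
  classical
  obtain ⟨k, v, rfl⟩ := posSemidef_iff_eq_sum_vecMulVec.mp hA
  obtain ⟨i, hi⟩ : ∃ i, v i ≠ 0 := by
    by_contra! hv
    exact h (by simp [hv])
  refine ⟨v i, hi, ?_⟩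
  rw [← Finset.sum_erase_add _ _ (Finset.mem_univ i), add_sub_cancel_right]
  exact posSemidef_sum _ fun j _ => posSemidef_vecMulVec_self_star _

/-- The orthogonal projection onto the line spanned by `u`. -/
def lineProj (u : n → ℂ) : Matrix n n ℂ := (star u ⬝ᵥ u)⁻¹ • vecMulVec u (star u)

theorem lineProj_mulVec_self {u : n → ℂ} (hu : u ≠ 0) : lineProj u *ᵥ u = u := by
  have : star u ⬝ᵥ u ≠ 0 := by simpa using hu
  simp [lineProj, smul_mulVec, vecMulVec_mulVec, smul_smul, this]

theorem isStarProjection_lineProj {u : n → ℂ} (hu : u ≠ 0) : IsStarProjection (lineProj u) := by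
  constructor
  · have : lineProj u * vecMulVec u (star u) = vecMulVec u (star u) := by
      rw [mul_vecMulVec, lineProj_mulVec_self hu]
    change lineProj u * lineProj u = lineProj u
    conv_lhs => rhs; rw [lineProj]
    rw [Matrix.mul_smul, this, lineProj]
  · change (lineProj u)ᴴ = lineProj u
    have : star (star u ⬝ᵥ u) = star u ⬝ᵥ u := by
      rw [← star_dotProduct_star, star_star, dotProduct_comm]
    rw [lineProj, conjTranspose_smul, star_inv₀, this, conjTranspose_vecMulVec, star_star]

theorem lineProj_conjTranspose {u : n → ℂ} (hu : u ≠ 0) : (lineProj u)ᴴ = lineProj u :=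
  (isStarProjection_lineProj hu).isSelfAdjoint

theorem star_vecMul_lineProj {u : n → ℂ} (hu : u ≠ 0) : star u ᵥ* lineProj u = star u := by
  rw [← lineProj_conjTranspose hu, vecMul_conjTranspose, star_star, lineProj_mulVec_self hu]

theorem lineProj_mul_mul_lineProj (u : n → ℂ) (A : Matrix n n ℂ) :
    lineProj u * A * lineProj u =
      ((star u ⬝ᵥ u)⁻¹ ^ 2 * (star u ⬝ᵥ A *ᵥ u)) • vecMulVec u (star u) := by
  rw [lineProj, smul_mul, smul_mul, vecMulVec_mul, Matrix.mul_smul, vecMulVec_mul_vecMulVec,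
    vecMulVec_smul, smul_smul, smul_smul, ← dotProduct_mulVec, sq]

theorem eq_smul_vecMulVec {A : Matrix n n ℂ} (hA : A.PosSemidef) {u : n → ℂ}
    (h : A * lineProj u = A) : ∃ t : ℝ, 0 ≤ t ∧ A = t • vecMulVec u (star u) := by
  have h' : lineProj u * A * lineProj u = A := by
    -- The inverse of 0 is 0, so `lineProj 0 = 0` and the hypothesis forces A = 0.
    by_cases hu : u = 0
    · subst hu; simpa [lineProj] using h
    · have h2 := congrArg conjTranspose h
      rw [conjTranspose_mul, hA.isHermitian.eq] at h2
      rw [lineProj_conjTranspose hu] at h2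
      rw [h2, h]
  rw [lineProj_mul_mul_lineProj] at h'
  have h0 : 0 ≤ star u ⬝ᵥ u := dotProduct_star_self_nonneg u
  have h1 : 0 ≤ (star u ⬝ᵥ u)⁻¹ ^ 2 * (star u ⬝ᵥ A *ᵥ u) :=
    mul_nonneg (pow_nonneg (inv_nonneg.mpr h0) _) (hA.dotProduct_mulVec_nonneg u)
  obtain ⟨t, ht, h2⟩ := RCLike.nonneg_iff_exists_ofReal.mp h1
  refine ⟨t, ht, ?_⟩
  rw [← h2] at h'
  rw [← h']
  ext i j
  simp

/-- Extremality of rank-one rays in the positive semidefinite cone: A vanishes on the kernel of uu*,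
so it lives on the line of u. -/
theorem eq_smul_vecMulVec_of_le {A : Matrix n n ℂ} (hA : A.PosSemidef) {u : n → ℂ}
    (h : (vecMulVec u (star u) - A).PosSemidef) :
    ∃ t : ℝ, 0 ≤ t ∧ A = t • vecMulVec u (star u) := by
  classical
  by_cases hu : u = 0
  · subst hu
    refine ⟨0, le_rfl, ?_⟩
    have := mul_eq_zero_of_le hA h (N := (1 : Matrix n n ℂ)) (by simp)
    simpa using this
  refine eq_smul_vecMulVec hA ?_
  have : A * (1 - lineProj u) = 0 := by
    refine mul_eq_zero_of_le hA h ?_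
    rw [mul_sub, mul_one, vecMulVec_mul, star_vecMul_lineProj hu, sub_self]
  rw [mul_sub, mul_one, sub_eq_zero] at this
  exact this.symm

theorem rank_vecMulVec_star {u : n → ℂ} (hu : u ≠ 0) : (vecMulVec u (star u)).rank = 1 := by
  refine le_antisymm (rank_vecMulVec_le _ _) (Nat.one_le_iff_ne_zero.mpr fun h => ?_)
  refine vecMulVec_star_ne_zero hu ?_
  have h0 := LinearMap.range_eq_bot.mp (Submodule.finrank_eq_zero.mp h)
  exact mulVec_injective (funext fun x => (congrArg (· x) h0).trans (zero_mulVec x).symm)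

theorem exists_eq_vecMulVec_of_rank_eq_one {A : Matrix n n ℂ} (hA : A.PosSemidef)
    (h : A.rank = 1) : ∃ u : n → ℂ, u ≠ 0 ∧ A = vecMulVec u (star u) := by
  classical
  obtain ⟨⟨w, x, hx⟩, hw, hspan⟩ := finrank_eq_one_iff'.mp h
  have hw0 : w ≠ 0 := fun h => hw (Subtype.ext h)
  have hP : lineProj w * A = A := by
    ext i j
    obtain ⟨c, hc⟩ := hspan ⟨A.mulVecLin (Pi.single j 1), _, rfl⟩
    have hc' : c • w = A *ᵥ Pi.single j 1 := congrArg Subtype.val hc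
    have h2 : lineProj w *ᵥ (A *ᵥ Pi.single j 1) = A *ᵥ Pi.single j 1 := by
      rw [← hc', mulVec_smul, lineProj_mulVec_self hw0]
    have h3 := congrFun h2 i
    rw [mulVec_mulVec] at h3
    simpa using h3
  have hP' : A * lineProj w = A := by
    have := congrArg conjTranspose hP
    rwa [conjTranspose_mul, hA.isHermitian.eq, lineProj_conjTranspose hw0] at this
  obtain ⟨t, ht, rfl⟩ := eq_smul_vecMulVec hA hP'
  have ht' := smul_vecMulVec_star ht w
  refine ⟨_, fun h0 => ?_, ht'⟩
  rw [ht', h0, zero_vecMulVec, rank_zero] at h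
  exact zero_ne_one h

end PosSemidef

variable {k m : ℕ}

/-! ### Corners W M_k W of projections -/

section Corner

theorem mem_corner_iff {W X : Mat k} (hW : IsStarProjection W) :
    X ∈ corner W ↔ W * X * W = X := by
  rw [mem_corner]
  refine ⟨?_, fun h => ⟨X, h⟩⟩
  rintro ⟨Y, rfl⟩
  have h : W * W = W := hW.isIdempotentElem
  rw [mul_assoc, mul_assoc, h, ← mul_assoc, ← mul_assoc, h]

theorem mem_corner_iff_mul_eq {W X : Mat k} (hW : IsStarProjection W) :
    X ∈ corner W ↔ W * X = X ∧ X * W = X := by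
  rw [mem_corner_iff hW]
  have h : W * W = W := hW.isIdempotentElem
  constructor
  · intro hX
    constructor
    · rw [← hX, ← mul_assoc, ← mul_assoc, h]
    · rw [← hX, mul_assoc, h]
  · rintro ⟨h1, h2⟩
    rw [h1, h2]

theorem corner_zero : corner (0 : Mat k) = ⊥ := by
  rw [eq_bot_iff]
  intro X hX
  obtain ⟨Y, rfl⟩ := mem_corner.mp hX
  simp

theorem isStarProjection_self_mem_corner {W : Mat k} (hW : IsStarProjection W) :
    W ∈ corner W := by
  have h : W * W = W := hW.isIdempotentElem
  rw [mem_corner_iff hW, h, h]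

theorem posSemidef_of_isStarProjection {W : Mat k} (hW : IsStarProjection W) :
    W.PosSemidef := by
  have h : W * W = W := hW.isIdempotentElem
  have h' : Wᴴ = W := hW.isSelfAdjoint
  rw [← h]
  nth_rw 1 [← h']
  exact posSemidef_conjTranspose_mul_self W

/-- The trace inner product detects membership of the compression to a corner being zero. -/
theorem mul_mul_eq_zero_of_orthogonal {W X : Mat k} (hW : IsStarProjection W)
    (h : ∀ Y ∈ corner W, (X * Yᴴ).trace = 0) : W * X * W = 0 := by
  have h1 : W * W = W := hW.isIdempotentElem
  have h2 : Wᴴ = W := hW.isSelfAdjoint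
  have h3 := h (W * X * W) (mem_corner.mpr ⟨X, rfl⟩)
  rw [← trace_mul_conjTranspose_self_eq_zero_iff]
  have : (W * X * W) * (W * X * W)ᴴ = W * (X * (W * X * W)ᴴ) := by
    simp only [conjTranspose_mul, h2, mul_assoc]
    rw [← mul_assoc W W, h1]
  rw [this, trace_mul_comm]
  have : X * (W * X * W)ᴴ * W = X * (W * X * W)ᴴ := by
    simp only [conjTranspose_mul, h2, mul_assoc, h1]
  rw [this, h3]

/-- Polarization. It reduces linear statements about all matrices to positive semidefinite ones. -/
theorem span_conjTranspose_mul_self (S : Submodule ℂ (Mat k)) (h : ∀ Z : Mat k, Zᴴ * Z ∈ S)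
    (Y : Mat k) : Y ∈ S := by
  have h1 : Y = (4 : ℂ)⁻¹ • (((1 + Y)ᴴ * (1 + Y)) - ((1 - Y)ᴴ * (1 - Y))
      - Complex.I • ((1 + Complex.I • Y)ᴴ * (1 + Complex.I • Y))
      + Complex.I • ((1 - Complex.I • Y)ᴴ * (1 - Complex.I • Y))) := by
    simp only [conjTranspose_add, conjTranspose_sub, conjTranspose_one, conjTranspose_smul,
      add_mul, mul_add, sub_mul, mul_sub, one_mul, mul_one, smul_mul, Matrix.mul_smul,
      smul_add, smul_sub, smul_smul, Complex.star_def, Complex.conj_I]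
    ext i j
    simp
    ring_nf
  rw [h1]
  exact S.smul_mem _ (S.add_mem (S.sub_mem (S.sub_mem (h _) (h _)) (S.smul_mem _ (h _)))
    (S.smul_mem _ (h _)))

end Corner

/-! ### The maps G_γ and F_γ, and invariance of corners -/

section Maps

theorem trace_gMap_mul (γ : BiMat k m) (X : Mat k) (Y : Mat m) :
    (gMap γ X * Y).trace = (γ * (X ⊗ₖ Y)).trace := by
  simp only [gMap, LinearMap.coe_mk, AddHom.coe_mk, trace, diag, mul_apply, of_apply,
    kroneckerMap_apply, Fintype.sum_prod_type, Finset.sum_mul]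
  conv_rhs => rw [Finset.sum_comm]
  refine Finset.sum_congr rfl fun b _ => ?_
  rw [Finset.sum_comm]
  refine Finset.sum_congr rfl fun a _ => ?_
  rw [Finset.sum_comm]
  refine Finset.sum_congr rfl fun c _ => Finset.sum_congr rfl fun d _ => ?_
  ring

theorem fMap_eq_gMap (γ : BiMat k m) : fMap γ = gMap (γ.submatrix Prod.swap Prod.swap) := rfl

theorem trace_fMap_mul (γ : BiMat k m) (Y : Mat m) (X : Mat k) :
    (fMap γ Y * X).trace = (gMap γ X * Y).trace := by
  rw [fMap_eq_gMap, trace_gMap_mul, trace_gMap_mul]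
  have h : Y ⊗ₖ X = (X ⊗ₖ Y).submatrix Prod.swap Prod.swap := by
    ext ⟨b, a⟩ ⟨d, c⟩
    simp [mul_comm]
  rw [h, show (Prod.swap : Fin m × Fin k → _) = Equiv.prodComm (Fin m) (Fin k) from rfl,
    submatrix_mul_equiv]
  exact Fintype.sum_equiv (Equiv.prodComm (Fin m) (Fin k)) _ _ fun _ => rfl

theorem gMap_apply_single (γ : BiMat k m) (a c : Fin k) (b d : Fin m) :
    gMap γ (single c a 1) b d = γ (a, b) (c, d) := by
  simp [gMap, single_apply, ite_and, Finset.sum_ite_eq]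

theorem gMap_injective {γ δ : BiMat k m} (h : ∀ X, gMap γ X = gMap δ X) : γ = δ := by
  ext ⟨a, b⟩ ⟨c, d⟩
  rw [← gMap_apply_single γ, h, gMap_apply_single]

theorem gMap_add (γ δ : BiMat k m) (X : Mat k) : gMap (γ + δ) X = gMap γ X + gMap δ X := by
  ext; simp [gMap, add_mul, Finset.sum_add_distrib]

theorem gMap_sub (γ δ : BiMat k m) (X : Mat k) : gMap (γ - δ) X = gMap γ X - gMap δ X := by
  ext; simp [gMap, sub_mul, Finset.sum_sub_distrib]

theorem fMap_sub (γ δ : BiMat k m) (X : Mat m) : fMap (γ - δ) X = fMap γ X - fMap δ X := by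
  ext; simp [fMap, sub_mul, Finset.sum_sub_distrib]

theorem gMap_smul (t : ℝ) (γ : BiMat k m) (X : Mat k) : gMap (t • γ) X = t • gMap γ X := by
  ext; simp [gMap, mul_assoc, Finset.mul_sum]

theorem gMap_sum {ι : Type*} (s : Finset ι) (γ : ι → BiMat k m) (X : Mat k) :
    gMap (∑ i ∈ s, γ i) X = ∑ i ∈ s, gMap (γ i) X := by
  classical
  induction s using Finset.induction_on with
  | empty => ext; simp [gMap]
  | insert i s hi ih => rw [Finset.sum_insert hi, Finset.sum_insert hi, gMap_add, ih]

theorem gMap_vecMulVec_star (γ : BiMat k m) (u : Fin k → ℂ) :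
    gMap γ (vecMulVec u (star u)) =
      (of fun (p : Fin k × Fin m) (d : Fin m) => if p.2 = d then u p.1 else 0)ᴴ * γ *
        of fun (p : Fin k × Fin m) (d : Fin m) => if p.2 = d then u p.1 else 0 := by
  ext b d
  simp only [gMap, LinearMap.coe_mk, AddHom.coe_mk, of_apply, mul_apply, conjTranspose_apply,
    Fintype.sum_prod_type, vecMulVec_apply, Pi.star_apply,
    Finset.sum_mul]
  simp only [apply_ite star, star_zero, ite_mul, zero_mul, mul_ite, mul_zero,
    Finset.sum_ite_irrel, Finset.sum_const_zero, Finset.sum_ite_eq', Finset.mem_univ, if_true]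
  rw [Finset.sum_comm]
  refine Finset.sum_congr rfl fun c _ => Finset.sum_congr rfl fun a _ => ?_
  ring

theorem gMap_posSemidef {γ : BiMat k m} (hγ : γ.PosSemidef) {X : Mat k} (hX : X.PosSemidef) :
    (gMap γ X).PosSemidef := by
  obtain ⟨r, v, rfl⟩ := posSemidef_iff_eq_sum_vecMulVec.mp hX
  rw [map_sum]
  refine posSemidef_sum _ fun i _ => ?_
  rw [gMap_vecMulVec_star]
  exact hγ.conjTranspose_mul_mul_same _

theorem fMap_posSemidef {γ : BiMat k m} (hγ : γ.PosSemidef) {Y : Mat m} (hY : Y.PosSemidef) :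
    (fMap γ Y).PosSemidef := by
  rw [fMap_eq_gMap]
  exact gMap_posSemidef (hγ.submatrix _) hY

theorem gMap_conjTranspose {γ : BiMat k m} (hγ : γ.PosSemidef) (X : Mat k) :
    (gMap γ X)ᴴ = gMap γ Xᴴ := by
  ext b d
  simp only [gMap, LinearMap.coe_mk, AddHom.coe_mk, of_apply, conjTranspose_apply, star_sum,
    star_mul']
  rw [Finset.sum_comm]
  refine Finset.sum_congr rfl fun c _ => Finset.sum_congr rfl fun a _ => ?_
  rw [← hγ.isHermitian.apply]
  simp

theorem trace_fMap_gMap_mul (γ : BiMat k m) (X Y : Mat k) :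
    ((fMap γ ∘ₗ gMap γ) X * Y).trace = (gMap γ X * gMap γ Y).trace := by
  rw [LinearMap.comp_apply, trace_fMap_mul, trace_mul_comm]

/-- By adjointness tr(G(X) G(X)*) = tr(F(G(X)) X*). -/
theorem gMap_eq_zero_of_fMap_gMap_eq_zero {γ : BiMat k m} (hγ : γ.PosSemidef) {X : Mat k}
    (h : (fMap γ ∘ₗ gMap γ) X = 0) : gMap γ X = 0 := by
  rw [← trace_mul_conjTranspose_self_eq_zero_iff, gMap_conjTranspose hγ, ← trace_fMap_gMap_mul,
    h, zero_mul, trace_zero]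

theorem fMap_gMap_posSemidef {γ : BiMat k m} (hγ : γ.PosSemidef) {X : Mat k}
    (hX : X.PosSemidef) : ((fMap γ ∘ₗ gMap γ) X).PosSemidef :=
  fMap_posSemidef hγ (gMap_posSemidef hγ hX)

/-- A corner is invariant exactly when the images under `gMap γ` of its projection and of the
complementary one are orthogonal. -/
theorem leavesInvariant_iff {γ : BiMat k m} (hγ : γ.PosSemidef) {W : Mat k}
    (hW : IsStarProjection W) :
    LeavesInvariant (fMap γ ∘ₗ gMap γ) W ↔ (gMap γ W * gMap γ (1 - W)).trace = 0 := by
  have h2 : Wᴴ = W := hW.isSelfAdjoint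
  have hW' : IsStarProjection (1 - W) := hW.one_sub
  have hzero {V A : Mat k} (hV : IsStarProjection V) (hA : A.PosSemidef)
      (h : (A * V).trace = 0) : A * V = 0 := by
    have e1 : V * V = V := hV.isIdempotentElem
    have e2 : Vᴴ = V := hV.isSelfAdjoint
    refine mul_eq_zero_of_conjTranspose_mul_mul_eq_zero hA ?_
    rw [← (hA.conjTranspose_mul_mul_same V).trace_eq_zero_iff, e2, mul_assoc, trace_mul_comm,
      mul_assoc, e1, h]
  constructor
  · intro h
    have h3 := ((mem_corner_iff_mul_eq hW).mp (h W (isStarProjection_self_mem_corner hW))).2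
    rw [← trace_fMap_gMap_mul, mul_sub, mul_one, h3, sub_self, trace_zero]
  · intro h
    -- Positivity upgrades the vanishing trace to a vanishing product.
    have h3 : (fMap γ ∘ₗ gMap γ) (1 - W) * W = 0 := by
      refine hzero hW (fMap_gMap_posSemidef hγ (posSemidef_of_isStarProjection hW')) ?_
      rw [trace_fMap_gMap_mul, trace_mul_comm, h]
    intro X hX
    obtain ⟨Y, rfl⟩ := mem_corner.mp hX
    let S : Submodule ℂ (Mat k) := (corner W).comap
      ((fMap γ ∘ₗ gMap γ) ∘ₗ LinearMap.mulLeft ℂ W ∘ₗ LinearMap.mulRight ℂ W)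
    suffices hS : ∀ Z : Mat k, Zᴴ * Z ∈ S by
      have := span_conjTranspose_mul_self S hS Y
      simpa [S, mul_assoc] using this
    intro Z
    have hP : (W * (Zᴴ * Z) * W).PosSemidef := by
      have := (posSemidef_conjTranspose_mul_self Z).conjTranspose_mul_mul_same W
      rwa [h2] at this
    have hT := fMap_gMap_posSemidef hγ hP
    -- Self-adjointness moves T onto 1 - W, where `h3` applies.
    have h4 : (fMap γ ∘ₗ gMap γ) (W * (Zᴴ * Z) * W) * (1 - W) = 0 := by
      refine hzero hW' hT ?_
      rw [trace_fMap_gMap_mul, trace_mul_comm, ← trace_fMap_gMap_mul, mul_assoc W,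
        ← mul_assoc _ W, h3, zero_mul, trace_zero]
    have h5 : (fMap γ ∘ₗ gMap γ) (W * (Zᴴ * Z) * W) ∈ corner W := by
      rw [mul_sub, mul_one, sub_eq_zero] at h4
      refine (mem_corner_iff_mul_eq hW).mpr ⟨?_, h4.symm⟩
      have := congrArg conjTranspose h4
      rw [conjTranspose_mul, hT.isHermitian.eq, h2] at this
      exact this.symm
    simpa [S, mul_assoc] using h5

/-- With δ = ε + cγ, the invariance trace of δ expands into four nonnegative terms, one of them c²
times that of γ. A corner invariant for δ is therefore invariant for γ. -/
theorem isIrreducibleOn_of_le {γ δ : BiMat k m} (hγ : γ.PosSemidef) {c : ℝ} (hc : 0 < c)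
    (hδ : (δ - c • γ).PosSemidef) {V : Mat k} (h : IsIrreducibleOn (fMap γ ∘ₗ gMap γ) V) :
    IsIrreducibleOn (fMap δ ∘ₗ gMap δ) V := by
  intro W hW hWV hinv
  refine h W hW hWV ?_
  obtain ⟨ε, rfl⟩ : ∃ ε, δ = ε + c • γ := ⟨δ - c • γ, by simp⟩
  rw [add_sub_cancel_right] at hδ
  rw [leavesInvariant_iff hγ hW]
  rw [leavesInvariant_iff (hδ.add (hγ.smul hc.le)) hW] at hinv
  have p1 := posSemidef_of_isStarProjection hW
  have p2 := posSemidef_of_isStarProjection hW.one_sub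
  have q1 := gMap_posSemidef hγ p1
  have q2 := gMap_posSemidef hγ p2
  have r1 := gMap_posSemidef hδ p1
  have r2 := gMap_posSemidef hδ p2
  simp only [gMap_add, gMap_smul, add_mul, mul_add, trace_add, smul_mul, Matrix.mul_smul,
    trace_smul, smul_smul] at hinv
  have hc' : 0 < c * c := mul_pos hc hc
  have s1 := trace_mul_nonneg r1 r2
  have s2 := smul_nonneg hc.le (trace_mul_nonneg r1 q2)
  have s3 := smul_nonneg hc.le (trace_mul_nonneg q1 r2)
  have s4 := smul_nonneg hc'.le (trace_mul_nonneg q1 q2)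
  have := (add_eq_zero_iff_of_nonneg (add_nonneg s1 s2) (add_nonneg s3 s4)).mp
    (by rw [← hinv]; abel)
  have := ((add_eq_zero_iff_of_nonneg s3 s4).mp this.2).2
  exact (smul_eq_zero.mp this).resolve_left hc'.ne'

end Maps

/-! ### Compression of a state to a corner -/

section Compress

/-- The compression `(W ⊗ 1) γ (W ⊗ 1)`. -/
def compress (W : Mat k) (γ : BiMat k m) : BiMat k m :=
  (W ⊗ₖ (1 : Mat m)) * γ * (W ⊗ₖ (1 : Mat m))

theorem gMap_compress (W : Mat k) (γ : BiMat k m) (X : Mat k) :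
    gMap (compress W γ) X = gMap γ (W * X * W) := by
  rw [ext_iff_trace_mul_right]
  intro Y
  rw [trace_gMap_mul, trace_gMap_mul, compress, mul_assoc, mul_assoc, trace_mul_comm, mul_assoc,
    mul_assoc, ← mul_kronecker_mul, ← mul_kronecker_mul, one_mul, mul_one, mul_assoc]

theorem fMap_compress (W : Mat k) (γ : BiMat k m) (Y : Mat m) :
    fMap (compress W γ) Y = W * fMap γ Y * W := by
  rw [ext_iff_trace_mul_right]
  intro X
  rw [trace_fMap_mul, gMap_compress, ← trace_fMap_mul, ← mul_assoc, trace_mul_comm, ← mul_assoc,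
    ← mul_assoc]

theorem compress_posSemidef {W : Mat k} (hW : IsStarProjection W) {γ : BiMat k m}
    (hγ : γ.PosSemidef) : (compress W γ).PosSemidef := by
  have h : Wᴴ = W := hW.isSelfAdjoint
  have := hγ.conjTranspose_mul_mul_same (W ⊗ₖ (1 : Mat m))
  rwa [conjTranspose_kronecker, conjTranspose_one, h] at this

theorem compress_compress {W : Mat k} (hW : IsStarProjection W) (γ : BiMat k m) :
    compress W (compress W γ) = compress W γ := by
  have h : W * W = W := hW.isIdempotentElem
  have h' : (W ⊗ₖ (1 : Mat m)) * (W ⊗ₖ (1 : Mat m)) = W ⊗ₖ (1 : Mat m) := by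
    rw [← mul_kronecker_mul, h, one_mul]
  simp only [compress, mul_assoc, h']
  rw [← mul_assoc, h']

theorem compress_smul (W : Mat k) (t : ℝ) (γ : BiMat k m) :
    compress W (t • γ) = t • compress W γ := by
  simp [compress]

theorem compress_eq_self_of_mul_eq_zero {W : Mat k} {γ : BiMat k m} (hW : IsStarProjection W)
    (hγ : γ.PosSemidef) (h : γ * (1 - W ⊗ₖ (1 : Mat m)) = 0) : compress W γ = γ := by
  have h' : Wᴴ = W := hW.isSelfAdjoint
  rw [mul_sub, mul_one, sub_eq_zero] at h
  have := congrArg conjTranspose h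
  rw [conjTranspose_mul, hγ.isHermitian.eq, conjTranspose_kronecker, conjTranspose_one, h'] at this
  rw [compress, ← this, ← h]

theorem mul_eq_zero_of_compress_eq_self {W : Mat k} {γ : BiMat k m} (hW : IsStarProjection W)
    (h : compress W γ = γ) : γ * (1 - W ⊗ₖ (1 : Mat m)) = 0 := by
  have hWW : W * W = W := hW.isIdempotentElem
  rw [← h, compress, mul_sub, mul_one, mul_assoc _ (W ⊗ₖ (1 : Mat m)) (W ⊗ₖ (1 : Mat m)),
    ← mul_kronecker_mul, hWW, one_mul, sub_self]

theorem compress_eq_self_of_le {W : Mat k} {γ δ : BiMat k m} (hW : IsStarProjection W)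
    (hδ : δ.PosSemidef) (hle : (γ - δ).PosSemidef) (h : compress W γ = γ) :
    compress W δ = δ :=
  compress_eq_self_of_mul_eq_zero hW hδ
    (mul_eq_zero_of_le hδ hle (mul_eq_zero_of_compress_eq_self hW h))

end Compress

/-! ### Block decomposition of completely reducible states -/

section CR

theorem isIrreducibleOn_congr {T T' : Mat k →ₗ[ℂ] Mat k} {V : Mat k}
    (h : ∀ X ∈ corner V, T' X = T X) (hT : IsIrreducibleOn T V) : IsIrreducibleOn T' V :=
  fun W hW hWV hinv => hT W hW hWV fun X hX => h X (hWV hX) ▸ hinv X hX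

theorem mem_CR_of_compress_eq_self {W : Mat k} {γ : BiMat k m} (hW : IsStarProjection W)
    (hγ : γ.PosSemidef) (h : compress W γ = γ)
    (hirr : IsIrreducibleOn (fMap γ ∘ₗ gMap γ) W) : γ ∈ CR k m := by
  refine ⟨hγ, 1, fun _ => W, fun _ => hW, fun i j hij => (hij (Subsingleton.elim i j)).elim,
    fun _ X _ => ?_, fun _ => hirr, fun X hX => ?_⟩
  · rw [LinearMap.comp_apply, ← h, fMap_compress]
    exact mem_corner.mpr ⟨_, rfl⟩
  · rw [LinearMap.comp_apply]
    nth_rw 2 [← h]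
    rw [gMap_compress, mul_mul_eq_zero_of_orthogonal hW (hX 0), map_zero, map_zero]

/-- Orthogonal decomposition of `X` along mutually orthogonal corners. -/
theorem orthogonal_sub_sum {l : ℕ} {W : Fin l → Mat k} (hW : ∀ i, IsStarProjection (W i))
    (hort : ∀ i j, i ≠ j → W i * W j = 0) (X : Mat k) (i : Fin l) (Y : Mat k)
    (hY : Y ∈ corner (W i)) : ((X - ∑ j, W j * X * W j) * Yᴴ).trace = 0 := by
  have h2 : (W i)ᴴ = W i := (hW i).isSelfAdjoint
  obtain ⟨e1, e2⟩ := (mem_corner_iff_mul_eq (hW i)).mp hY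
  have f1 : Yᴴ * W i = Yᴴ := by
    have := congrArg conjTranspose e1
    rwa [conjTranspose_mul, h2] at this
  have f2 : W i * Yᴴ = Yᴴ := by
    have := congrArg conjTranspose e2
    rwa [conjTranspose_mul, h2] at this
  have : (∑ j, W j * X * W j) * Yᴴ = W i * X * W i * Yᴴ := by
    rw [Finset.sum_mul]
    refine Finset.sum_eq_single i (fun j _ hj => ?_) (by simp)
    rw [← f2, mul_assoc _ (W j), ← mul_assoc (W j), hort j i hj, zero_mul, mul_zero]
  rw [sub_mul, this, trace_sub, mul_assoc, f2, mul_assoc, trace_mul_comm (W i), mul_assoc, f1,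
    sub_self]

variable {γ : BiMat k m} {l : ℕ} {W : Fin l → Mat k}

/-- X - ∑ W_i X W_i is orthogonal to every corner, hence killed by F ∘ G and so by G, and G
determines γ. -/
theorem eq_sum_compress (hγ : γ.PosSemidef) (hW : ∀ i, IsStarProjection (W i))
    (hort : ∀ i j, i ≠ j → W i * W j = 0)
    (hR : ∀ X : Mat k, (∀ i, ∀ Y ∈ corner (W i), (X * Yᴴ).trace = 0) →
      (fMap γ ∘ₗ gMap γ) X = 0) : γ = ∑ i, compress (W i) γ := by
  refine gMap_injective fun X => ?_
  have h := gMap_eq_zero_of_fMap_gMap_eq_zero hγ (hR _ (orthogonal_sub_sum hW hort X))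
  rw [map_sub, sub_eq_zero, map_sum] at h
  rw [h, gMap_sum]
  exact Finset.sum_congr rfl fun i _ => (gMap_compress _ _ _).symm

theorem fMap_gMap_compress_apply {V X : Mat k} (hV : IsStarProjection V)
    (hinv : LeavesInvariant (fMap γ ∘ₗ gMap γ) V) (hX : X ∈ corner V) :
    (fMap (compress V γ) ∘ₗ gMap (compress V γ)) X = (fMap γ ∘ₗ gMap γ) X := by
  rw [LinearMap.comp_apply, fMap_compress, gMap_compress, (mem_corner_iff hV).mp hX]
  exact (mem_corner_iff hV).mp (hinv X hX)

theorem compress_mem_CR {V : Mat k} (hγ : γ.PosSemidef) (hV : IsStarProjection V)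
    (hinv : LeavesInvariant (fMap γ ∘ₗ gMap γ) V)
    (hirr : IsIrreducibleOn (fMap γ ∘ₗ gMap γ) V) : compress V γ ∈ CR k m :=
  mem_CR_of_compress_eq_self hV (compress_posSemidef hV hγ) (compress_compress hV γ)
    (isIrreducibleOn_congr (fun _ hX => fMap_gMap_compress_apply hV hinv hX) hirr)

theorem sub_compress_mem_CR (hγ : γ.PosSemidef) (hW : ∀ i, IsStarProjection (W i))
    (hort : ∀ i j, i ≠ j → W i * W j = 0)
    (hinv : ∀ i, LeavesInvariant (fMap γ ∘ₗ gMap γ) (W i))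
    (hirr : ∀ i, IsIrreducibleOn (fMap γ ∘ₗ gMap γ) (W i))
    (hR : ∀ X : Mat k, (∀ i, ∀ Y ∈ corner (W i), (X * Yᴴ).trace = 0) →
      (fMap γ ∘ₗ gMap γ) X = 0) (i : Fin l) : γ - compress (W i) γ ∈ CR k m := by
  have hWi' : (W i)ᴴ = W i := (hW i).isSelfAdjoint
  have key {j : Fin l} (hj : j ≠ i) {X : Mat k} (hX : X ∈ corner (W j)) :
      (fMap (γ - compress (W i) γ) ∘ₗ gMap (γ - compress (W i) γ)) X
        = (fMap γ ∘ₗ gMap γ) X := by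
    have hz {Z : Mat k} (hZ : Z ∈ corner (W j)) : W i * Z * W i = 0 := by
      rw [← ((mem_corner_iff_mul_eq (hW j)).mp hZ).1, ← mul_assoc, hort i j hj.symm, zero_mul,
        zero_mul]
    rw [LinearMap.comp_apply, gMap_sub, gMap_compress, hz hX, map_zero, sub_zero, fMap_sub,
      fMap_compress, ← LinearMap.comp_apply, hz (hinv j X hX), sub_zero]
  have hpos : (γ - compress (W i) γ).PosSemidef := by
    nth_rw 1 [eq_sum_compress hγ hW hort hR]
    rw [← Finset.sum_erase_add _ _ (Finset.mem_univ i), add_sub_cancel_right]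
    exact posSemidef_sum _ fun j _ => compress_posSemidef (hW j) hγ
  -- Replacing W_i by the zero projection avoids reindexing the family.
  refine ⟨hpos, l, fun j => if j = i then 0 else W j, fun j => ?_, fun j j' hj => ?_,
    fun j => ?_, fun j => ?_, fun X hX => ?_⟩
  · dsimp only
    split_ifs
    exacts [IsStarProjection.zero _, hW j]
  · dsimp only
    split_ifs
    exacts [zero_mul _, zero_mul _, mul_zero _, hort j j' hj]
  · dsimp only
    split_ifs with h
    · intro X hX
      rw [corner_zero, Submodule.mem_bot] at hX
      rw [hX, map_zero]
      exact Submodule.zero_mem _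
    · intro X hX
      rw [key h hX]
      exact hinv j X hX
  · dsimp only
    split_ifs with h
    · intro V hV hVW _
      left
      have := hVW (isStarProjection_self_mem_corner hV)
      rwa [corner_zero, Submodule.mem_bot] at this
    · exact isIrreducibleOn_congr (fun _ hX => key h hX) (hirr j)
  -- X is orthogonal only to the corners j ≠ i; removing its i-th block makes it orthogonal to all
  -- of them.
  · have h0 : gMap γ (X - W i * X * W i) = 0 := by
      refine gMap_eq_zero_of_fMap_gMap_eq_zero hγ (hR _ fun j Y hY => ?_)
      have e2 := ((mem_corner_iff_mul_eq (hW j)).mp hY).2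
      have e1 := ((mem_corner_iff_mul_eq (hW j)).mp hY).1
      by_cases hj : j = i
      · subst hj
        have f1 : Yᴴ * W j = Yᴴ := by
          have := congrArg conjTranspose e1
          rwa [conjTranspose_mul, hWi'] at this
        have f2 : W j * Yᴴ = Yᴴ := by
          have := congrArg conjTranspose e2
          rwa [conjTranspose_mul, hWi'] at this
        rw [sub_mul, trace_sub, mul_assoc, f2, mul_assoc, trace_mul_comm (W j), mul_assoc, f1,
          sub_self]
      · have f2 : W i * Yᴴ = 0 := by
          have : Y * W i = 0 := by rw [← e2, mul_assoc, hort j i hj, mul_zero]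
          have := congrArg conjTranspose this
          rwa [conjTranspose_mul, hWi', conjTranspose_zero] at this
        have h3 := hX j Y (by simpa [hj] using hY)
        rw [sub_mul, mul_assoc (W i * X), f2, mul_zero, sub_zero, h3]
    rw [LinearMap.comp_apply, gMap_sub, gMap_compress, ← map_sub, h0, map_zero]

/-- A generator of an extreme ray is supported on a single corner, where it acts irreducibly. -/
theorem exists_irreducible_of_isExtremeRay {x : BiMat k m}
    (hx0 : x ≠ 0) (h : IsExtremeRay (CR k m) (ray x)) :
    x.PosSemidef ∧ ∃ W : Mat k, IsStarProjection W ∧ compress W x = x ∧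
      IsIrreducibleOn (fMap x ∘ₗ gMap x) W := by
  have hxr : x ∈ ray x := ⟨1, one_pos, (one_smul _ _).symm⟩
  obtain ⟨hx, l, W, hW, hort, hinv, hirr, hR⟩ := h.2.1 hxr
  refine ⟨hx, ?_⟩
  obtain ⟨i, hi⟩ : ∃ i, compress (W i) x ≠ 0 := by
    by_contra! h0
    exact hx0 ((eq_sum_compress hx hW hort hR).trans (by simp [h0]))
  have h1 := (h.2.2 _ (compress_mem_CR hx (hW i) (hinv i) (hirr i)) _
    (sub_compress_mem_CR hx hW hort hinv hirr hR i) (by simpa using hxr)).1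
  obtain ⟨t, ht, h2⟩ := h1.resolve_right hi
  refine ⟨W i, hW i, ?_, hirr i⟩
  have h3 := compress_compress (hW i) x
  -- The block is t x with t > 0, so idempotence of the compression shows that it fixes x itself.
  rw [h2, compress_smul] at h3
  have h4 : t • (compress (W i) x - x) = 0 := by rw [smul_sub, h3, sub_self]
  exact sub_eq_zero.mp ((smul_eq_zero.mp h4).resolve_left ht.ne')

end CR

/-! ### Extreme rays and product vectors -/

section Pure

theorem exists_eq_vecMulVec_of_isExtremeRay {x : BiMat k m} (hx0 : x ≠ 0)
    (h : IsExtremeRay (CR k m) (ray x)) : ∃ v : Fin k × Fin m → ℂ, x = vecMulVec v (star v) := by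
  obtain ⟨hx, W, hW, hWx, hirr⟩ := exists_irreducible_of_isExtremeRay hx0 h
  obtain ⟨u, hu, hux⟩ := exists_vecMulVec_le hx hx0
  set U := vecMulVec u (star u) with hU
  have hUpos : U.PosSemidef := posSemidef_vecMulVec_self_star u
  -- As U ≤ x, these weights give A ≥ x/2 and B ≥ x/4, so both inherit irreducibility from x.
  set A : BiMat k m := (1 / 2 : ℝ) • x + (1 / 4 : ℝ) • U with hA
  set B : BiMat k m := (1 / 2 : ℝ) • x - (1 / 4 : ℝ) • U with hB
  have hAB : A + B = x := by rw [hA, hB]; module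
  have hBx : (B - (1 / 4 : ℝ) • x).PosSemidef := by
    rw [show B - (1 / 4 : ℝ) • x = (1 / 4 : ℝ) • (x - U) by rw [hB]; module]
    exact hux.smul (by norm_num)
  have hAx : (A - (1 / 2 : ℝ) • x).PosSemidef := by
    rw [hA, add_sub_cancel_left]
    exact hUpos.smul (by norm_num)
  have hApos : A.PosSemidef :=
    (hx.smul (by norm_num : (0 : ℝ) ≤ 1 / 2)).add (hUpos.smul (by norm_num : (0 : ℝ) ≤ 1 / 4))
  have hBpos : B.PosSemidef := by
    rw [← sub_add_cancel B ((1 / 4 : ℝ) • x)]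
    exact hBx.add (hx.smul (by norm_num))
  have hACR : A ∈ CR k m := mem_CR_of_compress_eq_self hW hApos
    (compress_eq_self_of_le hW hApos (by rwa [← hAB, add_sub_cancel_left]) hWx)
    (isIrreducibleOn_of_le hx (by norm_num) hAx hirr)
  have hBCR : B ∈ CR k m := mem_CR_of_compress_eq_self hW hBpos
    (compress_eq_self_of_le hW hBpos (by rwa [← hAB, add_sub_cancel_right]) hWx)
    (isIrreducibleOn_of_le hx (by norm_num) hBx hirr)
  have hray : ∃ s : ℝ, A = s • x := by
    rcases (h.2.2 A hACR B hBCR ⟨1, one_pos, by rw [hAB, one_smul]⟩).1 with ⟨s, -, hs⟩ | h0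
    exacts [⟨s, hs⟩, ⟨0, by rw [h0, zero_smul]⟩]
  obtain ⟨s, hs⟩ := hray
  have hUx : U = (4 * s - 2) • x := by
    have : U = (4 : ℝ) • A - (2 : ℝ) • x := by rw [hA]; module
    rw [this, hs]; module
  have hc : 4 * s - 2 ≠ 0 := fun h0 =>
    vecMulVec_star_ne_zero hu (by rw [← hU, hUx, h0, zero_smul])
  have hUP : U * lineProj u = U := by
    rw [hU, vecMulVec_mul, star_vecMul_lineProj hu]
  have hxP : x * lineProj u = x := by
    rw [show x = (4 * s - 2)⁻¹ • U by rw [hUx, inv_smul_smul₀ hc], smul_mul, hUP]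
  obtain ⟨t, ht, hxt⟩ := eq_smul_vecMulVec hx hxP
  exact ⟨_, hxt.trans (smul_vecMulVec_star ht u)⟩

/-- The transpose here cancels the one in `fMap_vecMulVec`, leaving F(G(X)) = UU* X UU*. -/
theorem gMap_vecMulVec (U : Matrix (Fin k) (Fin m) ℂ) (X : Mat k) :
    gMap (vecMulVec (fun p => U p.1 p.2) (star fun p => U p.1 p.2)) X = (Uᴴ * X * U)ᵀ := by
  ext b d
  simp only [gMap, LinearMap.coe_mk, AddHom.coe_mk, of_apply, vecMulVec_apply, Pi.star_apply,
    transpose_apply, mul_apply, conjTranspose_apply, Finset.sum_mul]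
  refine Finset.sum_congr rfl fun a _ => Finset.sum_congr rfl fun c _ => ?_
  ring

theorem fMap_vecMulVec (U : Matrix (Fin k) (Fin m) ℂ) (Y : Mat m) :
    fMap (vecMulVec (fun p => U p.1 p.2) (star fun p => U p.1 p.2)) Y = U * Yᵀ * Uᴴ := by
  ext a c
  simp only [fMap, LinearMap.coe_mk, AddHom.coe_mk, of_apply, vecMulVec_apply, Pi.star_apply,
    transpose_apply, mul_apply, conjTranspose_apply, Finset.sum_mul]
  rw [Finset.sum_comm]
  refine Finset.sum_congr rfl fun b _ => Finset.sum_congr rfl fun d _ => ?_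
  ring

/-- A pure state on which the associated map acts irreducibly comes from a product vector. -/
theorem exists_eq_mul_of_irreducible {U : Matrix (Fin k) (Fin m) ℂ} {γ : BiMat k m}
    (hγ : γ = vecMulVec (fun p => U p.1 p.2) (star fun p => U p.1 p.2)) (hU : U ≠ 0)
    {W : Mat k} (hW : IsStarProjection W) (hWγ : compress W γ = γ)
    (hirr : IsIrreducibleOn (fMap γ ∘ₗ gMap γ) W) :
    ∃ (a : Fin k → ℂ) (b : Fin m → ℂ), U = vecMulVec a b := by
  have hWW : W * W = W := hW.isIdempotentElem
  have hWs : Wᴴ = W := hW.isSelfAdjoint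
  set P := U * Uᴴ with hP
  have hPh : Pᴴ = P := isHermitian_mul_conjTranspose_self U
  have hP0 : P ≠ 0 := fun h => hU (self_mul_conjTranspose_eq_zero.mp h)
  have hWP : W * P = P := by
    have h1 := fMap_compress W γ 1
    rw [hWγ, hγ, fMap_vecMulVec, transpose_one, Matrix.mul_one, ← hP] at h1
    rw [h1, ← mul_assoc, ← mul_assoc, hWW]
  obtain ⟨e, t, ht, he, het⟩ :=
    IsHermitian.exists_eigenvector_of_ne_zero (A := P) hPh hP0
  have hWe : W *ᵥ e = e := by
    have h1 : W *ᵥ (P *ᵥ e) = P *ᵥ e := by rw [mulVec_mulVec, hWP]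
    rw [het, mulVec_smul] at h1
    exact smul_right_injective _ ht h1
  have hLs := lineProj_conjTranspose he
  have hWL : W * lineProj e = lineProj e := by
    rw [lineProj, Matrix.mul_smul, mul_vecMulVec, hWe]
  have hLW : lineProj e * W = lineProj e := by
    have := congrArg conjTranspose hWL
    rwa [conjTranspose_mul, hWs, hLs] at this
  have hPL : P * lineProj e = t • lineProj e := by
    rw [lineProj, Matrix.mul_smul, mul_vecMulVec, het, smul_vecMulVec, smul_comm]
  have hLP : lineProj e * P = t • lineProj e := by
    have := congrArg conjTranspose hPL
    rwa [conjTranspose_mul, hPh, hLs, conjTranspose_smul, hLs, star_trivial] at this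
  have hL0 : lineProj e ≠ 0 := fun h => he (by simpa [h] using (lineProj_mulVec_self he).symm)
  -- X ↦ P X P scales the corner of the eigenline by t², so that corner is invariant.
  have hLeq : lineProj e = W := by
    refine (hirr _ (isStarProjection_lineProj he) (fun X hX => ?_) fun X hX => ?_).resolve_left hL0
    · obtain ⟨Y, rfl⟩ := mem_corner.mp hX
      refine mem_corner.mpr ⟨lineProj e * Y * lineProj e, ?_⟩
      rw [← mul_assoc, ← mul_assoc, hWL, mul_assoc _ _ W, hLW]
    · obtain ⟨Y, rfl⟩ := mem_corner.mp hX
      have : (fMap γ ∘ₗ gMap γ) (lineProj e * Y * lineProj e)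
          = (P * lineProj e) * Y * (lineProj e * P) := by
        rw [LinearMap.comp_apply, hγ, gMap_vecMulVec, fMap_vecMulVec, transpose_transpose, hP]
        simp only [Matrix.mul_assoc]
      rw [this, hPL, hLP]
      refine mem_corner.mpr ⟨(t * t) • Y, ?_⟩
      simp only [Matrix.mul_smul, smul_mul, smul_smul]
  -- P = UU* has the same range as U, so W also fixes U.
  have hWU : W * U = U := by
    have h1 : ((1 - W) * U) * ((1 - W) * U)ᴴ = 0 := by
      rw [conjTranspose_mul, Matrix.mul_assoc, ← Matrix.mul_assoc U, ← hP, ← Matrix.mul_assoc,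
        sub_mul, one_mul, hWP, sub_self, zero_mul]
    have h2 := self_mul_conjTranspose_eq_zero.mp h1
    rw [Matrix.sub_mul, Matrix.one_mul, sub_eq_zero] at h2
    exact h2.symm
  refine ⟨(star e ⬝ᵥ e)⁻¹ • e, star e ᵥ* U, ?_⟩
  rw [smul_vecMulVec, ← vecMulVec_mul, ← smul_mul]
  exact (hLeq ▸ hWU).symm

theorem vecMulVec_mul_kronecker (a : Fin k → ℂ) (b : Fin m → ℂ) :
    vecMulVec (fun p : Fin k × Fin m => a p.1 * b p.2) (star fun p => a p.1 * b p.2)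
      = vecMulVec a (star a) ⊗ₖ vecMulVec b (star b) := by
  ext ⟨i, j⟩ ⟨i', j'⟩
  simp [vecMulVec_apply]
  ring

/-- The corner is one-dimensional, so W is c times `lineProj a` with c² = c. -/
theorem isIrreducibleOn_lineProj (T : Mat k →ₗ[ℂ] Mat k) {a : Fin k → ℂ} (ha : a ≠ 0) :
    IsIrreducibleOn T (lineProj a) := by
  intro W hW hWa _
  have hWW : W * W = W := hW.isIdempotentElem
  have hLL : lineProj a * lineProj a = lineProj a := (isStarProjection_lineProj ha).isIdempotentElem
  have h1 := (mem_corner_iff (isStarProjection_lineProj ha)).mp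
    (hWa (isStarProjection_self_mem_corner hW))
  have ha' : star a ⬝ᵥ a ≠ 0 := by simpa using ha
  obtain ⟨c, hc⟩ : ∃ c : ℂ, W = c • lineProj a := by
    rw [lineProj_mul_mul_lineProj] at h1
    refine ⟨(star a ⬝ᵥ a)⁻¹ ^ 2 * (star a ⬝ᵥ W *ᵥ a) * (star a ⬝ᵥ a), ?_⟩
    rw [lineProj, smul_smul, mul_assoc _ _ (star a ⬝ᵥ a)⁻¹, mul_inv_cancel₀ ha', mul_one, h1]
  rw [hc, smul_mul, Matrix.mul_smul, hLL, smul_smul] at hWW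
  by_cases hc0 : c = 0
  · left; rw [hc, hc0, zero_smul]
  · right
    have h2 : c • (c • lineProj a - lineProj a) = 0 := by
      rw [smul_sub, smul_smul, hWW, sub_self]
    rw [hc]
    exact sub_eq_zero.mp ((smul_eq_zero.mp h2).resolve_left hc0)

theorem smul_product_mem_CR {a : Fin k → ℂ} (ha : a ≠ 0) (b : Fin m → ℂ) {t : ℝ} (ht : 0 ≤ t) :
    t • (vecMulVec a (star a) ⊗ₖ vecMulVec b (star b)) ∈ CR k m := by
  have hL := isStarProjection_lineProj ha
  refine mem_CR_of_compress_eq_self hL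
    (((posSemidef_vecMulVec_self_star a).kronecker (posSemidef_vecMulVec_self_star b)).smul ht) ?_
    (isIrreducibleOn_lineProj _ ha)
  rw [compress_smul, compress, ← mul_kronecker_mul, ← mul_kronecker_mul, one_mul, mul_one,
    mul_vecMulVec, lineProj_mulVec_self ha, vecMulVec_mul, star_vecMul_lineProj ha]

/-- A nonzero summand C_i ⊗ D_i dominates some product aa* ⊗ bb*. So does γ, and having rank one it
must be proportional to that product. -/
theorem exists_eq_smul_product {γ : BiMat k m} (hp : IsPure γ) (hs : IsSeparable γ) :
    ∃ (a : Fin k → ℂ) (b : Fin m → ℂ) (t : ℝ), a ≠ 0 ∧ 0 ≤ t ∧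
      γ = t • (vecMulVec a (star a) ⊗ₖ vecMulVec b (star b)) := by
  obtain ⟨u, hu, hγu⟩ := exists_eq_vecMulVec_of_rank_eq_one hp.1 hp.2
  obtain ⟨n, C, D, hC, hD, hγ⟩ := hs
  obtain ⟨i, hi⟩ : ∃ i, C i ⊗ₖ D i ≠ 0 := by
    by_contra! h0
    exact vecMulVec_star_ne_zero hu (by rw [← hγu, hγ]; simp [h0])
  have hCi : C i ≠ 0 := fun h => hi (by simp [h])
  have hDi : D i ≠ 0 := fun h => hi (by simp [h])
  obtain ⟨a, ha, haC⟩ := exists_vecMulVec_le (hC i) hCi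
  obtain ⟨b, hb, hbD⟩ := exists_vecMulVec_le (hD i) hDi
  have hpos := (posSemidef_vecMulVec_self_star a).kronecker (posSemidef_vecMulVec_self_star b)
  have hle : (γ - vecMulVec a (star a) ⊗ₖ vecMulVec b (star b)).PosSemidef := by
    have h1 : γ - vecMulVec a (star a) ⊗ₖ vecMulVec b (star b)
        = ∑ j ∈ Finset.univ.erase i, C j ⊗ₖ D j
          + ((C i - vecMulVec a (star a)) ⊗ₖ D i
            + vecMulVec a (star a) ⊗ₖ (D i - vecMulVec b (star b))) := by
      rw [hγ, ← Finset.sum_erase_add _ _ (Finset.mem_univ i)]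
      ext p q
      simp only [Matrix.sub_apply, Matrix.add_apply, kroneckerMap_apply]
      ring
    rw [h1]
    exact (posSemidef_sum _ fun j _ => (hC j).kronecker (hD j)).add
      ((haC.kronecker (hD i)).add ((posSemidef_vecMulVec_self_star a).kronecker hbD))
  rw [hγu] at hle
  obtain ⟨t, ht, hab⟩ := eq_smul_vecMulVec_of_le hpos hle
  rw [← hγu] at hab
  have ht0 : t ≠ 0 := by
    rintro rfl
    rw [zero_smul, ← vecMulVec_mul_kronecker] at hab
    refine vecMulVec_star_ne_zero (fun h0 => ?_) hab
    obtain ⟨i, hi⟩ := Function.ne_iff.mp ha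
    obtain ⟨j, hj⟩ := Function.ne_iff.mp hb
    exact mul_ne_zero hi hj (congrFun h0 (i, j))
  exact ⟨a, b, t⁻¹, ha, inv_nonneg.mpr ht, by rw [hab, inv_smul_smul₀ ht0]⟩

/-- The ray of a positive semidefinite matrix of rank one is extreme in the cone of positive
semidefinite matrices. -/
theorem mem_ray_or_eq_zero {γ A B : BiMat k m} (hγ : γ.PosSemidef) (hrank : γ.rank = 1)
    (hA : A.PosSemidef) (hB : B.PosSemidef) (h : A + B ∈ ray γ) : A ∈ ray γ ∨ A = 0 := by
  obtain ⟨u, -, rfl⟩ := exists_eq_vecMulVec_of_rank_eq_one hγ hrank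
  obtain ⟨t, ht, hAB⟩ := h
  have hle : (vecMulVec u (star u) - t⁻¹ • A).PosSemidef := by
    rw [← inv_smul_smul₀ ht.ne' (vecMulVec u (star u)), ← hAB, ← smul_sub, add_sub_cancel_left]
    exact hB.smul (inv_nonneg.mpr ht.le)
  obtain ⟨s, hs, hAs⟩ := eq_smul_vecMulVec_of_le (hA.smul (inv_nonneg.mpr ht.le)) hle
  have hA' : A = (t * s) • vecMulVec u (star u) := by
    rw [mul_smul, ← hAs, smul_inv_smul₀ ht.ne']
  rcases hs.eq_or_lt with rfl | hs
  · right; rw [hA', mul_zero, zero_smul]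
  · exact Or.inl ⟨t * s, mul_pos ht hs, hA'⟩

end Pure

end CompletelyReducible

end

theorem mainTheorem3 (k m : ℕ) (r : Set (CompletelyReducible.BiMat k m)) :
    CompletelyReducible.IsExtremeRay (CompletelyReducible.CR k m) r ↔
      ∃ γ : CompletelyReducible.BiMat k m, CompletelyReducible.IsPure γ ∧
        CompletelyReducible.IsSeparable γ ∧ r = CompletelyReducible.ray γ := by
  constructor
  · intro h
    obtain ⟨x, hx0, rfl⟩ := h.1
    obtain ⟨hx, W, hW, hWx, hirr⟩ :=
      CompletelyReducible.exists_irreducible_of_isExtremeRay hx0 h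
    obtain ⟨v, rfl⟩ := CompletelyReducible.exists_eq_vecMulVec_of_isExtremeRay hx0 h
    have hv : v ≠ 0 := by
      rintro rfl
      exact hx0 (Matrix.zero_vecMulVec _)
    obtain ⟨a, b, hab⟩ := CompletelyReducible.exists_eq_mul_of_irreducible
      (U := Matrix.of fun i j => v (i, j)) rfl
      (fun h0 => hv (funext fun p => congrFun (congrFun h0 p.1) p.2)) hW hWx hirr
    have hvab : v = fun p => a p.1 * b p.2 :=
      funext fun p => congrFun (congrFun hab p.1) p.2
    refine ⟨_, ⟨hx, CompletelyReducible.rank_vecMulVec_star hv⟩,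
      ⟨1, fun _ => Matrix.vecMulVec a (star a), fun _ => Matrix.vecMulVec b (star b),
        fun _ => Matrix.posSemidef_vecMulVec_self_star a,
        fun _ => Matrix.posSemidef_vecMulVec_self_star b, ?_⟩, rfl⟩
    rw [Fin.sum_univ_one, ← CompletelyReducible.vecMulVec_mul_kronecker, hvab]
  · rintro ⟨γ, hp, hs, rfl⟩
    obtain ⟨a, b, t, ha, ht, hγ⟩ := CompletelyReducible.exists_eq_smul_product hp hs
    -- The decomposition condition uses only that A and B are positive semidefinite.
    refine ⟨⟨γ, ?_, rfl⟩, ?_, fun A hA B hB hAB =>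
      ⟨CompletelyReducible.mem_ray_or_eq_zero hp.1 hp.2 hA.1 hB.1 hAB,
        CompletelyReducible.mem_ray_or_eq_zero hp.1 hp.2 hB.1 hA.1 (add_comm A B ▸ hAB)⟩⟩
    · rintro rfl
      simpa using hp.2
    · rintro _ ⟨s, hs0, rfl⟩
      rw [hγ, smul_smul]
      exact CompletelyReducible.smul_product_mem_CR ha b (mul_nonneg hs0.le ht)
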